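/- Let $r\ge 2$ and let $E\subseteq\{0,\dots,r-1\}^2$ be the edge set of a directed graph on $r$ states that is irreducible (strongly connected) and aperiodic; put $d=|E|-r$ (then $d\ge 1$). For every state $i$ choose one edge $(i,\mathrm{dep}(i))\in E$. A transition matrix with edge set $E$ is determined by the vector $p\in(0,1)^{d}$ of its transition probabilities along the $d$ remaining edges; the acceptable vectors are those with positive coordinates such that, for each state $i$, the coordinates of the edges out of $i$ sum to less than $1$. There are $n$ users. Their parameter vectors $\mathbf p_1,\dots,\mathbf p_n$ are drawn independently from a bounded probability density $f$ on $\mathbb R^d$ that vanishes outside the acceptable vectors. Given the parameters, the data $X_u(1),\dots,X_u(m)\in\{0,\dots,r-1\}$ of the users are independent Markov chains, $X_u$ having the transition matrix given by $\mathbf p_u$ and an arbitrary initial law (which may depend measurably on $\mathbf p_u$). Each user has an error probability $R_u$, uniform on $[0,a_n]$, the $R_u$ being independent of each other and of the parameters and data; given these, each sample $X_u(k)$ is independently reported as $Z_u(k)$, where $Z_u(k)=X_u(k)$ with probability $1-R_u$ and $Z_u(k)=l$ with probability $R_u/(r-1)$ for each $l\ne X_u(k)$. A uniformly random permutation $\Pi$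 of the users, independent of everything else, is applied: $Y_j=Z_{\Pi^{-1}(j)}$. The adversary knows $\mathbf p_1,\dots,\mathbf p_n$ and observes $Y=(Y_1,\dots,Y_n)$. Let $c,c',\alpha>0$ and $\beta>\alpha/4$, let $m=m(n)$ be $c\,n^{\frac{2}{|E|-r}+\alpha}$ rounded up or down to an integer, and let $a_n=c'\,n^{-\left(\frac{1}{|E|-r}+\beta\right)}$ (with $n$ so large that $a_n\le 1$). Then the adversary can de-anonymize and recover the data of user $1$: there are measurable estimators $\widehat{\Pi(1)}$ and $\widetilde{X_1(k)}$, $1\le k\le m(n)$, that are functions of $(\mathbf p_1,\dots,\mathbf p_n,Y)$ only and do not depend on $f$ or on the initial laws, such that for every such $f$ and all such initial laws, as $n\to\infty$, $$P\bigl(\widehat{\Pi(1)}\ne\Pi(1)\bigr)\to 0\qquad\text{and}\qquad \max_{1\le k\le m(n)}P\bigl(\widetilde{X_1(k)}\ne X_1(k)\bigr)\to 0 .$$ -/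

import Mathlib

open MeasureTheory ProbabilityTheory Filter Topology
open scoped ENNReal NNReal

noncomputable section

namespace MarkovPrivacy

/-- There is a walk with `n` steps from `i` to `j` along the edges in `E`. -/
def HasWalk {r : ℕ} (E : Finset (Fin r × Fin r)) : ℕ → Fin r → Fin r → Prop
  | 0, i, j => i = j
  | n + 1, i, j => ∃ l, (i, l) ∈ E ∧ HasWalk E n l j

/-- Every state can be reached from every state. -/
def IsIrreducible {r : ℕ} (E : Finset (Fin r × Fin r)) : Prop :=
  ∀ i j, ∃ n, HasWalk E n i j

/-- For every state, the greatest common divisor of the lengths of the closed walks through that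
state is `1`. -/
def IsAperiodic {r : ℕ} (E : Finset (Fin r × Fin r)) : Prop :=
  ∀ i, ∀ d : ℕ, (∀ n, 0 < n → HasWalk E n i i → d ∣ n) → d = 1

/-- The free edges: all edges except, for each state `i`, the one edge `(i, dep i)` whose
probability is determined by the others. There are `|E| - r` of them. -/
abbrev FreeEdge {r : ℕ} (E : Finset (Fin r × Fin r)) (dep : Fin r → Fin r) : Type :=
  {e : Fin r × Fin r // e ∈ E ∧ e.2 ≠ dep e.1}

/-- The parameter vector of one user: the transition probabilities along the free edges. -/
abbrev Params {r : ℕ} (E : Finset (Fin r × Fin r)) (dep : Fin r → Fin r) : Type :=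
  FreeEdge E dep → ℝ

/-- The transition matrix that is determined by a parameter vector. -/
def transProb {r : ℕ} (E : Finset (Fin r × Fin r)) (dep : Fin r → Fin r) (p : Params E dep)
    (i l : Fin r) : ℝ :=
  if h : (i, l) ∈ E ∧ l ≠ dep i then p ⟨(i, l), h⟩
  else if l = dep i then 1 - ∑ e : FreeEdge E dep, (if e.1.1 = i then p e else 0)
  else 0

/-- The parameter vectors for which exactly the edges in `E` have positive probability. -/
def paramRange {r : ℕ} (E : Finset (Fin r × Fin r)) (dep : Fin r → Fin r) : Set (Params E dep) :=
  {p | (∀ e, 0 < p e) ∧ ∀ i, ∑ e : FreeEdge E dep, (if e.1.1 = i then p e else 0) < 1}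

/-- A bounded probability density on the parameter vectors (with respect to Lebesgue measure)
that vanishes outside the range of acceptable parameter vectors. -/
structure IsParamDensity {r : ℕ} (E : Finset (Fin r × Fin r)) (dep : Fin r → Fin r)
    (f : Params E dep → ℝ≥0) : Prop where
  measurable : Measurable f
  lintegral_eq_one : ∫⁻ p, (f p : ℝ≥0∞) = 1
  bounded : ∃ δ : ℝ≥0, ∀ p, f p ≤ δ
  eq_zero : ∀ p, p ∉ paramRange E dep → f p = 0

/-- The law of the parameter vector of one user. -/
def paramLaw {r : ℕ} {E : Finset (Fin r × Fin r)} {dep : Fin r → Fin r}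
    (f : Params E dep → ℝ≥0) : Measure (Params E dep) :=
  volume.withDensity fun p => (f p : ℝ≥0∞)

/-- The uniform law on `[0, a]`. -/
def noiseLaw (a : ℝ) : Measure ℝ := volume[|Set.Icc 0 a]

/-- A string of `m` samples; position `k` stands for time `k + 1`. -/
abbrev Samples (r m : ℕ) : Type := Fin m → Fin r

/-- The probability that a Markov chain with initial law `μ₀` and the transition matrix given by
`p` produces the string `x`. -/
def chainProb {r : ℕ} (E : Finset (Fin r × Fin r)) (dep : Fin r → Fin r) {m : ℕ}
    (μ₀ : Measure (Fin r)) (p : Params E dep) (x : Samples r m) : ℝ≥0∞ :=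
  ∏ k : Fin m,
    if (k : ℕ) = 0 then μ₀ {x k}
    else ENNReal.ofReal (transProb E dep p (x ⟨k - 1, by omega⟩) (x k))

/-- The `r`-ary symmetric channel with error probability `ρ`: the probability that the sample `i`
is reported as `l`. -/
def channel (r : ℕ) (ρ : ℝ) (i l : Fin r) : ℝ := if l = i then 1 - ρ else ρ / ((r : ℝ) - 1)

/-- What concerns one user: `((p, R), (X, Z))` with the parameter vector `p`, the error
probability `R`, the data `X` and the obfuscated data `Z`. -/
abbrev UserOutcome {r : ℕ} (E : Finset (Fin r × Fin r)) (dep : Fin r → Fin r) (m : ℕ) : Type :=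
  (Params E dep × ℝ) × (Samples r m × Samples r m)

/-- The joint law of `((p, R), (X, Z))` for one user: `p` has density `f`, independently `R` is
uniform on `[0, a]`; given these, `X` is a Markov chain with parameter vector `p` (and initial law
`init p`) and each sample of `X` goes independently through the channel with error
probability `R`. -/
def userLaw {r : ℕ} {E : Finset (Fin r × Fin r)} {dep : Fin r → Fin r}
    (f : Params E dep → ℝ≥0) (init : Kernel (Params E dep) (Fin r)) (m : ℕ) (a : ℝ) :
    Measure (UserOutcome E dep m) :=
  (((paramLaw f).prod (noiseLaw a)).prod Measure.count).withDensity fun ω =>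
    chainProb E dep (init ω.1.1) ω.1.1 ω.2.1 *
      ∏ k, ENNReal.ofReal (channel r ω.1.2 (ω.2.1 k) (ω.2.2 k))

instance (N : ℕ) : MeasurableSpace (Equiv.Perm (Fin N)) := ⊤

/-- The outcomes of the experiment with `N` users: the outcomes of all users and the
permutation `Π` (user `u` has the pseudonym `Π u`). -/
abbrev Outcome {r : ℕ} (E : Finset (Fin r × Fin r)) (dep : Fin r → Fin r) (N m : ℕ) : Type :=
  (Fin N → UserOutcome E dep m) × Equiv.Perm (Fin N)

/-- The law of the experiment: independent users and an independent uniform permutation. -/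
def law {r : ℕ} {E : Finset (Fin r × Fin r)} {dep : Fin r → Fin r}
    (f : Params E dep → ℝ≥0) (init : ℕ → Kernel (Params E dep) (Fin r)) (N m : ℕ) (a : ℝ) :
    Measure (Outcome E dep N m) :=
  (Measure.pi fun u : Fin N => userLaw f (init u) m a).prod
    (PMF.uniformOfFintype (Equiv.Perm (Fin N))).toMeasure

/-- The actual data `X_u` of user `u`. -/
def userData {r : ℕ} {E : Finset (Fin r × Fin r)} {dep : Fin r → Fin r} {N m : ℕ}
    (ω : Outcome E dep N m) (u : Fin N) : Samples r m := (ω.1 u).2.1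

/-- The obfuscated data `Z_u` of user `u`. -/
def obfuscated {r : ℕ} {E : Finset (Fin r × Fin r)} {dep : Fin r → Fin r} {N m : ℕ}
    (ω : Outcome E dep N m) (u : Fin N) : Samples r m := (ω.1 u).2.2

/-- The anonymized data, `Y_j = Z_{Π⁻¹(j)}`. -/
def anonymized {r : ℕ} {E : Finset (Fin r × Fin r)} {dep : Fin r → Fin r} {N m : ℕ}
    (ω : Outcome E dep N m) (j : Fin N) : Samples r m := obfuscated ω (ω.2.symm j)

/-- What the adversary may use: the parameter vectors of all users and the anonymized data. -/
abbrev Knowledge {r : ℕ} (E : Finset (Fin r × Fin r)) (dep : Fin r → Fin r) (N m : ℕ) : Type :=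
  (Fin N → Params E dep) × (Fin N → Samples r m)

/-- What the adversary knows when the outcome is `ω`. -/
def knowledge {r : ℕ} {E : Finset (Fin r × Fin r)} {dep : Fin r → Fin r} {N m : ℕ}
    (ω : Outcome E dep N m) : Knowledge E dep N m :=
  (fun u => (ω.1 u).1.1, anonymized ω)

/-- The probability that the adversary's guess of the pseudonym of user `u` is wrong. -/
def identificationError {r : ℕ} {E : Finset (Fin r × Fin r)} {dep : Fin r → Fin r} {N m : ℕ}
    (P : Measure (Outcome E dep N m)) (identify : Knowledge E dep N m → Fin N) (u : Fin N) :
    ℝ≥0∞ :=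
  P {ω | identify (knowledge ω) ≠ ω.2 u}

/-- The probability `P_e(u, k)` that the adversary's estimate of the sample of user `u` at
position `k` is wrong. -/
def recoveryError {r : ℕ} {E : Finset (Fin r × Fin r)} {dep : Fin r → Fin r} {N m : ℕ}
    (P : Measure (Outcome E dep N m)) (recover : Knowledge E dep N m → Samples r m)
    (u : Fin N) (k : Fin m) : ℝ≥0∞ :=
  P {ω | recover (knowledge ω) k ≠ userData ω u k}

end MarkovPrivacy

end

/-! The adversary accepts a pseudonym if all empirical transition frequencies of its data lie within
`Δ` of the parameters of user 1, and reads off the data reported under an accepted pseudonym.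

No false match: with the outcomes of the other users frozen, a given string is accepted only for
parameters of user 1 in a cube of side `2Δ` (`paramLaw_accepts_le`). As the density is bounded, the
union over the others costs a constant times `n (2Δ)^d`, where `d = |E| - r`.

The true match survives: the transitions from `i` to `j`, minus their probability times the visits
to `i`, form a martingale with second moment at most `m` (`second_moment_le`), whatever the initial
law, so no mixing estimate is needed. Misreports change the counts by at most twice their number,
whose mean is at most `m a`. Dividing by the visits requires every state to be visited of order `m`
times: by pigeonhole some state is, and visits propagate along walks (`visits_ge_of_hasWalk`),
losing a factor `θ` per step if all edges have probability at least `θ`. Such a `θ` exists outside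
an event of small probability (`exists_paramLaw_smallEdge_le`).

With `Δ = n^(-(1/d + α/4))`, the union bound decays like `n^(-dα/4)`. The relative noise `a` is of
smaller order than `Δ` exactly because `β > α/4`, and the fluctuations, of relative order
`m^(-1/2)`, are smaller than `Δ` because `α > 0`. -/

noncomputable section

namespace MarkovPrivacy

/-! ### Walks and the number of free edges. -/

section Graph

variable {r : ℕ} {E : Finset (Fin r × Fin r)} {dep : Fin r → Fin r}

lemma exists_walk_length_le (hirr : IsIrreducible E) :
    ∃ L : ℕ, ∀ i j, ∃ n ≤ L, HasWalk E n i j := by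
  choose w hw using hirr
  refine ⟨∑ i, ∑ j, w i j, fun i j => ⟨w i j, ?_, hw i j⟩⟩
  exact (Finset.single_le_sum (f := fun j => w i j) (fun _ _ => Nat.zero_le _)
    (Finset.mem_univ j)).trans
    (Finset.single_le_sum (f := fun i => ∑ j, w i j) (fun _ _ => Nat.zero_le _)
    (Finset.mem_univ i))

lemma hasWalk_iff_iterate (hdep : ∀ i, (i, dep i) ∈ E) (hE : ∀ e ∈ E, e.2 = dep e.1) (n : ℕ) :
    ∀ i j, HasWalk E n i j ↔ dep^[n] i = j := by
  induction n with
  | zero => intro i j; rfl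
  | succ n ih =>
    intro i j
    constructor
    · rintro ⟨l, hl, hw⟩
      have := hE _ hl
      simp only at this
      subst this
      rw [Function.iterate_succ_apply]
      exact (ih _ _).1 hw
    · intro h
      exact ⟨dep i, hdep i, (ih _ _).2 (by rwa [Function.iterate_succ_apply] at h)⟩

/-- An irreducible aperiodic graph on at least two states has a free edge. -/
lemma nonempty_freeEdge (hr : 2 ≤ r) (hirr : IsIrreducible E) (hap : IsAperiodic E)
    (hdep : ∀ i, (i, dep i) ∈ E) : Nonempty (FreeEdge E dep) := by
  by_contra hne
  have hE : ∀ e ∈ E, e.2 = dep e.1 := by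
    intro e he
    by_contra h
    exact hne ⟨⟨e, he, h⟩⟩
  have hfix : ∀ i, dep i = i := by
    intro i
    have h1 : Function.minimalPeriod dep i = 1 := by
      refine hap i _ fun n _ hw => ?_
      exact Function.IsPeriodicPt.minimalPeriod_dvd ((hasWalk_iff_iterate hdep hE n i i).1 hw)
    exact Function.minimalPeriod_eq_one_iff_isFixedPt.1 h1
  obtain ⟨n, hn⟩ := hirr ⟨0, by omega⟩ ⟨1, by omega⟩
  rw [hasWalk_iff_iterate hdep hE, Function.iterate_fixed (hfix _)] at hn
  simp at hn

lemma card_freeEdge (hdep : ∀ i, (i, dep i) ∈ E) :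
    Fintype.card (FreeEdge E dep) + r = E.card := by
  classical
  have h1 : Fintype.card (FreeEdge E dep) = (E.filter fun e => e.2 ≠ dep e.1).card := by
    rw [Fintype.card_subtype]
    congr 1
    ext e
    simp
  have h2 : (E.filter fun e => ¬ e.2 ≠ dep e.1).card = r := by
    have : (E.filter fun e => ¬ e.2 ≠ dep e.1) = Finset.univ.image fun i => (i, dep i) := by
      ext ⟨i, j⟩
      simp only [ne_eq, not_not, Finset.mem_filter, Finset.mem_image, Finset.mem_univ, true_and,
        Prod.mk.injEq]
      constructor
      · rintro ⟨_, h⟩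
        exact ⟨i, rfl, h.symm⟩
      · rintro ⟨_, rfl, rfl⟩
        exact ⟨hdep _, rfl⟩
    rw [this, Finset.card_image_of_injective _ fun i j h => (Prod.mk.inj h).1, Finset.card_univ,
      Fintype.card_fin]
  rw [h1, ← Finset.card_filter_add_card_filter_not (s := E) (fun e => e.2 ≠ dep e.1), h2]

end Graph

/-! ### The transition matrix of a parameter vector. -/

section Transition

variable {r : ℕ} {E : Finset (Fin r × Fin r)} {dep : Fin r → Fin r}

lemma transProb_freeEdge (p : Params E dep) (e : FreeEdge E dep) :
    transProb E dep p e.1.1 e.1.2 = p e := by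
  simp [transProb, e.2.1, e.2.2]

lemma sum_transProb (p : Params E dep) (i : Fin r) : ∑ l, transProb E dep p i l = 1 := by
  classical
  -- Extension by zero to all pairs turns the sum over the subtype into a row sum.
  set F : Fin r × Fin r → ℝ :=
    fun e => if h : e ∈ E ∧ e.2 ≠ dep e.1 then p ⟨e, h⟩ else 0 with hF
  have h1 : ∑ e : FreeEdge E dep, (if e.1.1 = i then p e else 0) = ∑ l, F (i, l) := by
    have h2 : ∀ e : FreeEdge E dep, (if e.1.1 = i then p e else 0)
        = (fun e : Fin r × Fin r => if e.1 = i then F e else 0) e.1 := by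
      intro e
      simp [hF, e.2.1, e.2.2]
    rw [Finset.sum_congr rfl fun e _ => h2 e]
    refine (Finset.sum_subtype
      (Finset.univ.filter fun e : Fin r × Fin r => e ∈ E ∧ e.2 ≠ dep e.1)
      (by simp) fun e : Fin r × Fin r => if e.1 = i then F e else 0).symm.trans ?_
    rw [Finset.sum_filter_of_ne, Fintype.sum_prod_type, Finset.sum_eq_single i]
    · simp
    · intro b _ hb
      simp [hb]
    · simp
    · intro e _ he
      by_contra h
      simp [hF, h] at he
  have h3 : ∀ l, transProb E dep p i l = F (i, l) +
      if l = dep i then 1 - ∑ l, F (i, l) else 0 := by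
    intro l
    simp only [transProb, h1, hF]
    by_cases hl : l = dep i
    · simp [hl]
    · simp [hl]
  simp [h3, Finset.sum_add_distrib]

lemma transProb_nonneg {p : Params E dep} (hp : p ∈ paramRange E dep) (i l : Fin r) :
    0 ≤ transProb E dep p i l := by
  unfold transProb
  split_ifs with h1 h2
  · exact (hp.1 _).le
  · linarith [hp.2 i]
  · exact le_rfl

lemma transProb_pos {p : Params E dep} (hp : p ∈ paramRange E dep) {e : Fin r × Fin r}
    (he : e ∈ E) : 0 < transProb E dep p e.1 e.2 := by
  by_cases h : e.2 = dep e.1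
  · simpa [transProb, h] using hp.2 e.1
  · simpa [transProb, h, he] using hp.1 ⟨e, he, h⟩

lemma transProb_le_one {p : Params E dep} (hp : p ∈ paramRange E dep) (i l : Fin r) :
    transProb E dep p i l ≤ 1 := by
  rw [← sum_transProb p i]
  exact Finset.single_le_sum (fun l _ => transProb_nonneg hp i l) (Finset.mem_univ l)

lemma measurable_transProb (i l : Fin r) :
    Measurable fun p : Params E dep => transProb E dep p i l := by
  unfold transProb
  split_ifs with h1 h2
  · fun_prop
  · refine measurable_const.sub (Finset.measurable_sum _ fun e _ => ?_)
    split_ifs <;> fun_prop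
  · fun_prop

end Transition

/-! ### Deterministic estimates for visits and transitions. -/

section Counts

variable {r m : ℕ}

/-- The number of visits to `i` before the last sample. -/
def visits (x : Samples r m) (i : Fin r) : ℝ :=
  ∑ k : Fin (m - 1), if x ⟨k, by omega⟩ = i then 1 else 0

/-- The number of transitions from `i` to `j`. -/
def transitions (x : Samples r m) (i j : Fin r) : ℝ :=
  ∑ k : Fin (m - 1), if x ⟨k, by omega⟩ = i ∧ x ⟨k + 1, by omega⟩ = j then 1 else 0

/-- The number of samples that are reported wrongly. -/
def mismatches (x z : Samples r m) : ℝ := ∑ k, if z k ≠ x k then 1 else 0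

lemma sum_visits (x : Samples r m) : ∑ i, visits x i = ((m - 1 : ℕ) : ℝ) := by
  unfold visits
  rw [Finset.sum_comm]
  simp

lemma exists_visits_ge (hr : 0 < r) (x : Samples r m) :
    ∃ i, ((m - 1 : ℕ) : ℝ) / r ≤ visits x i := by
  have : Nonempty (Fin r) := ⟨⟨0, hr⟩⟩
  have h : ∑ _i : Fin r, ((m - 1 : ℕ) : ℝ) / r ≤ ∑ i, visits x i := by
    rw [sum_visits, Finset.sum_const, Finset.card_univ, Fintype.card_fin, nsmul_eq_mul,
      mul_div_cancel₀ _ (by positivity)]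
  obtain ⟨i, _, hi⟩ := Finset.exists_le_of_sum_le Finset.univ_nonempty h
  exact ⟨i, hi⟩

/-- Each such transition ends in a visit to `j`; the extra `1` pays for the last sample, which
`visits` does not count. -/
lemma transitions_le (x : Samples r m) (i j : Fin r) : transitions x i j ≤ visits x j + 1 := by
  rcases m with _ | M
  · simp [transitions, visits]
  change (∑ k : Fin M, if x k.castSucc = i ∧ x k.succ = j then (1 : ℝ) else 0)
    ≤ (∑ k : Fin M, if x k.castSucc = j then (1 : ℝ) else 0) + 1
  have h1 := Fin.sum_univ_castSucc fun k => if x k = j then (1 : ℝ) else 0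
  have h2 := Fin.sum_univ_succ fun k => if x k = j then (1 : ℝ) else 0
  have h3 : (∑ k : Fin M, if x k.castSucc = i ∧ x k.succ = j then (1 : ℝ) else 0)
      ≤ ∑ k : Fin M, if x k.succ = j then (1 : ℝ) else 0 := by
    refine Finset.sum_le_sum fun k _ => ?_
    split_ifs <;> simp_all
  have h4 : (if x (Fin.last M) = j then (1 : ℝ) else 0) ≤ 1 := by split_ifs <;> simp
  have h5 : 0 ≤ (if x 0 = j then (1 : ℝ) else 0) := by split_ifs <;> simp
  linarith

lemma sum_mismatch_le_mismatches {M : ℕ} (x z : Samples r (M + 1)) :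
    (∑ k : Fin M, if z k.castSucc ≠ x k.castSucc then (1 : ℝ) else 0) ≤ mismatches x z ∧
    (∑ k : Fin M, if z k.succ ≠ x k.succ then (1 : ℝ) else 0) ≤ mismatches x z := by
  unfold mismatches
  constructor
  · rw [Fin.sum_univ_castSucc]
    have : 0 ≤ if z (Fin.last M) ≠ x (Fin.last M) then (1 : ℝ) else 0 := by split_ifs <;> simp
    linarith
  · rw [Fin.sum_univ_succ]
    have : 0 ≤ if z 0 ≠ x 0 then (1 : ℝ) else 0 := by split_ifs <;> simp
    linarith

lemma abs_visits_sub_le (x z : Samples r m) (i : Fin r) :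
    |visits z i - visits x i| ≤ mismatches x z := by
  rcases m with _ | M
  · simp [visits, mismatches]
  refine le_trans ?_ (sum_mismatch_le_mismatches x z).1
  change |(∑ k : Fin M, if z k.castSucc = i then (1 : ℝ) else 0)
    - (∑ k : Fin M, if x k.castSucc = i then (1 : ℝ) else 0)| ≤ _
  rw [← Finset.sum_sub_distrib]
  refine (Finset.abs_sum_le_sum_abs _ _).trans (Finset.sum_le_sum fun k _ => ?_)
  split_ifs <;> simp_all

/-- A wrong sample spoils at most two transitions: the one that enters it and the one that leaves
it. -/
lemma abs_transitions_sub_le (x z : Samples r m) (i j : Fin r) :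
    |transitions z i j - transitions x i j| ≤ 2 * mismatches x z := by
  rcases m with _ | M
  · simp [transitions, mismatches]
  have h := sum_mismatch_le_mismatches x z
  suffices h2 : |transitions z i j - transitions x i j| ≤
      (∑ k : Fin M, if z k.castSucc ≠ x k.castSucc then (1 : ℝ) else 0) +
      (∑ k : Fin M, if z k.succ ≠ x k.succ then (1 : ℝ) else 0) by linarith [h.1, h.2]
  change |(∑ k : Fin M, if z k.castSucc = i ∧ z k.succ = j then (1 : ℝ) else 0)
    - (∑ k : Fin M, if x k.castSucc = i ∧ x k.succ = j then (1 : ℝ) else 0)| ≤ _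
  rw [← Finset.sum_sub_distrib, ← Finset.sum_add_distrib]
  refine (Finset.abs_sum_le_sum_abs _ _).trans (Finset.sum_le_sum fun k _ => ?_)
  by_cases h1 : z k.castSucc = x k.castSucc <;> by_cases h2 : z k.succ = x k.succ
  · simp [h1, h2]
  all_goals
    simp only [h1, h2, ne_eq, not_true_eq_false, not_false_eq_true, if_true, if_false]
    split_ifs <;> norm_num

lemma measurable_visits (i : Fin r) : Measurable fun z : Samples r m => visits z i :=
  Measurable.of_discrete

lemma measurable_transitions (i j : Fin r) :
    Measurable fun z : Samples r m => transitions z i j :=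
  Measurable.of_discrete

/-- If all transitions are about as frequent as they should be, a walk from `i` to `j` transports
visits of `i` to visits of `j`. -/
lemma visits_ge_of_hasWalk {E : Finset (Fin r × Fin r)} {dep : Fin r → Fin r} {p : Params E dep}
    {θ s : ℝ} (hθ : 0 ≤ θ) (hθ1 : θ ≤ 1) (hs : 0 ≤ s)
    (hp : ∀ e ∈ E, θ ≤ transProb E dep p e.1 e.2) {x : Samples r m}
    (hx : ∀ e ∈ E, |transitions x e.1 e.2 - transProb E dep p e.1 e.2 * visits x e.1| ≤ s)
    (n : ℕ) : ∀ i j, HasWalk E n i j → θ ^ n * visits x i - n * (s + 1) ≤ visits x j := by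
  have hv : ∀ i, 0 ≤ visits x i := fun i =>
    Finset.sum_nonneg fun k _ => by split_ifs <;> norm_num
  induction n with
  | zero =>
    rintro i j rfl
    simp
  | succ n ih =>
    rintro i j ⟨l, hl, hw⟩
    have h1 := ih l j hw
    have h2 := (abs_le.1 (hx _ hl)).1
    have h3 := transitions_le x i l
    have h4 := mul_le_mul_of_nonneg_right (hp _ hl) (hv i)
    simp only at h2 h4
    -- One edge costs the factor `θ`, the fluctuation `s` and the boundary term `1`.
    have h5 : θ * visits x i - (s + 1) ≤ visits x l := by linarith
    have h6 := mul_le_mul_of_nonneg_left h5 (pow_nonneg hθ n)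
    have h7 : θ ^ n * (s + 1) ≤ 1 * (s + 1) :=
      mul_le_mul_of_nonneg_right (pow_le_one₀ hθ hθ1) (by linarith)
    push_cast
    rw [pow_succ]
    linarith

end Counts

/-! ### The Markov chain and its transition martingale. -/

section Chain

variable {r : ℕ} {E : Finset (Fin r × Fin r)} {dep : Fin r → Fin r}

/-- The Markov property in the form that allows induction on the length: a new last sample depends
on the past only through the previous one. -/
lemma chainProb_snoc {M : ℕ} (μ₀ : Measure (Fin r)) (p : Params E dep) (x : Samples r (M + 1))
    (l : Fin r) :
    chainProb E dep μ₀ p (Fin.snoc x l : Samples r (M + 2)) =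
      chainProb E dep μ₀ p x * ENNReal.ofReal (transProb E dep p (x (Fin.last M)) l) := by
  unfold chainProb
  rw [Fin.prod_univ_castSucc]
  have hlast : (⟨((Fin.last (M + 1) : Fin (M + 2)) : ℕ) - 1, by omega⟩ : Fin (M + 2))
      = (Fin.last M).castSucc := by
    ext; simp
  rw [hlast]
  congr 1
  · refine Finset.prod_congr rfl fun k _ => ?_
    have hk : (⟨((k.castSucc : Fin (M + 2)) : ℕ) - 1, by omega⟩ : Fin (M + 2))
        = Fin.castSucc ⟨k - 1, by omega⟩ := by
      ext; simp
    rw [hk, Fin.snoc_castSucc (α := fun _ => Fin r), Fin.snoc_castSucc (α := fun _ => Fin r)]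
    simp
  · rw [Fin.snoc_castSucc (α := fun _ => Fin r), Fin.snoc_last (α := fun _ => Fin r)]
    simp

lemma sum_samples_succ {M : ℕ} (F : Samples r (M + 1) → ℝ≥0∞) :
    ∑ x, F x = ∑ x : Samples r M, ∑ l : Fin r, F (Fin.snoc x l) := by
  rw [← (Fin.snocEquiv fun _ : Fin (M + 1) => Fin r).sum_comp, Fintype.sum_prod_type,
    Finset.sum_comm]
  rfl

lemma sum_ofReal_transProb {p : Params E dep} (hp : p ∈ paramRange E dep) (i : Fin r) :
    ∑ l, ENNReal.ofReal (transProb E dep p i l) = 1 := by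
  rw [← ENNReal.ofReal_sum_of_nonneg fun l _ => transProb_nonneg hp i l, sum_transProb,
    ENNReal.ofReal_one]

lemma sum_chainProb (μ₀ : Measure (Fin r)) [IsProbabilityMeasure μ₀] {p : Params E dep}
    (hp : p ∈ paramRange E dep) (m : ℕ) : ∑ x : Samples r m, chainProb E dep μ₀ p x = 1 := by
  rcases m with _ | M
  · simp [chainProb]
  induction M with
  | zero =>
    rw [sum_samples_succ]
    simp [chainProb, Fin.snoc]
  | succ M ih =>
    rw [sum_samples_succ]
    simp_rw [chainProb_snoc, ← Finset.mul_sum, sum_ofReal_transProb hp, mul_one]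
    exact ih

lemma visits_snoc {M : ℕ} (x : Samples r (M + 1)) (l i : Fin r) :
    visits (Fin.snoc x l : Samples r (M + 2)) i
      = visits x i + if x (Fin.last M) = i then 1 else 0 := by
  change (∑ k : Fin (M + 1), if (Fin.snoc x l : Samples r (M + 2)) k.castSucc = i
    then (1 : ℝ) else 0) = (∑ k : Fin M, if x k.castSucc = i then (1 : ℝ) else 0) + _
  simp_rw [Fin.snoc_castSucc (α := fun _ => Fin r)]
  rw [Fin.sum_univ_castSucc]

lemma transitions_snoc {M : ℕ} (x : Samples r (M + 1)) (l i j : Fin r) :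
    transitions (Fin.snoc x l : Samples r (M + 2)) i j
      = transitions x i j + if x (Fin.last M) = i ∧ l = j then 1 else 0 := by
  change (∑ k : Fin (M + 1), if (Fin.snoc x l : Samples r (M + 2)) k.castSucc = i ∧
    (Fin.snoc x l : Samples r (M + 2)) k.succ = j then (1 : ℝ) else 0) =
    (∑ k : Fin M, if x k.castSucc = i ∧ x k.succ = j then (1 : ℝ) else 0) + _
  simp_rw [Fin.snoc_castSucc (α := fun _ => Fin r)]
  rw [Fin.sum_univ_castSucc]
  simp_rw [Fin.succ_castSucc, Fin.snoc_castSucc (α := fun _ => Fin r), Fin.succ_last,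
    Fin.snoc_last (α := fun _ => Fin r)]

/-- The martingale that compares the number of transitions with its compensator has a second
moment that grows at most linearly. -/
lemma second_moment_le (μ₀ : Measure (Fin r)) [IsProbabilityMeasure μ₀] {p : Params E dep}
    (hp : p ∈ paramRange E dep) (i j : Fin r) (m : ℕ) :
    ∑ x : Samples r m, chainProb E dep μ₀ p x *
      ENNReal.ofReal ((transitions x i j - transProb E dep p i j * visits x i) ^ 2) ≤ m := by
  rcases m with _ | M
  · simp [transitions, visits]
  suffices h : ∑ x : Samples r (M + 1), chainProb E dep μ₀ p x *
      ENNReal.ofReal ((transitions x i j - transProb E dep p i j * visits x i) ^ 2) ≤ M from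
    h.trans (by gcongr; omega)
  induction M with
  | zero => simp [transitions, visits]
  | succ M ih =>
    rw [sum_samples_succ]
    simp_rw [chainProb_snoc, transitions_snoc, visits_snoc, mul_assoc, ← Finset.mul_sum]
    have key : ∀ x : Samples r (M + 1),
        ∑ l, ENNReal.ofReal (transProb E dep p (x (Fin.last M)) l) * ENNReal.ofReal
          ((transitions x i j + (if x (Fin.last M) = i ∧ l = j then 1 else 0) -
            transProb E dep p i j *
              (visits x i + if x (Fin.last M) = i then 1 else 0)) ^ 2) ≤
        ENNReal.ofReal ((transitions x i j - transProb E dep p i j * visits x i) ^ 2) + 1 := by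
      intro x
      set S := transitions x i j - transProb E dep p i j * visits x i with hS
      simp_rw [← ENNReal.ofReal_mul (transProb_nonneg hp _ _)]
      rw [← ENNReal.ofReal_sum_of_nonneg fun l _ =>
        mul_nonneg (transProb_nonneg hp _ _) (sq_nonneg _), ← ENNReal.ofReal_one,
        ← ENNReal.ofReal_add (sq_nonneg _) zero_le_one]
      refine ENNReal.ofReal_le_ofReal ?_
      by_cases hx : x (Fin.last M) = i
      · set q := transProb E dep p i j with hq
        -- At a visit to `i` the increment is `1 - q` or `-q`. It has conditional mean zero, so the
        -- cross term cancels and the second moment grows by `q - q ^ 2 ≤ 1`.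
        have hterm : ∀ l, transProb E dep p i l *
            (transitions x i j + (if l = j then 1 else 0) - q * (visits x i + 1)) ^ 2
            = transProb E dep p i l * (S - q) ^ 2
              + if l = j then q * (2 * (S - q) + 1) else 0 := by
          intro l
          by_cases hl : l = j
          · subst hl
            simp only [if_true, hS, ← hq]
            ring
          · simp only [hl, if_false, hS]
            ring
        simp only [hx, true_and, if_true]
        rw [Finset.sum_congr rfl fun l _ => hterm l, Finset.sum_add_distrib, ← Finset.sum_mul,
          sum_transProb, Finset.sum_ite_eq' Finset.univ j]
        have h0 := transProb_nonneg hp i j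
        have h1 := transProb_le_one hp i j
        simp only [Finset.mem_univ, if_true]
        nlinarith
      · simp only [hx, false_and, if_false, add_zero]
        rw [← Finset.sum_mul, sum_transProb]
        linarith
    refine (Finset.sum_le_sum fun x _ => mul_le_mul_right (key x) _).trans ?_
    simp_rw [mul_add, mul_one]
    rw [Finset.sum_add_distrib, sum_chainProb μ₀ hp]
    push_cast
    gcongr

end Chain

/-! ### The symmetric channel and the mean number of misreports. -/

section Channel

variable {r m : ℕ}

/-- The probability that the samples `x` are reported as `z`. -/
def channelProb (ρ : ℝ) (x z : Samples r m) : ℝ≥0∞ :=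
  ∏ k, ENNReal.ofReal (channel r ρ (x k) (z k))

lemma sum_channel (hr : 2 ≤ r) {ρ : ℝ} (h0 : 0 ≤ ρ) (h1 : ρ ≤ 1) (i : Fin r) :
    ∑ l, ENNReal.ofReal (channel r ρ i l) = 1 ∧
    ∑ l, ENNReal.ofReal (channel r ρ i l) * (if l ≠ i then 1 else 0) = ENNReal.ofReal ρ := by
  have hr' : (0 : ℝ) < (r : ℝ) - 1 := by
    have : (2 : ℝ) ≤ r := by exact_mod_cast hr
    linarith
  have hsec : ∑ l, ENNReal.ofReal (channel r ρ i l) * (if l ≠ i then 1 else 0)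
      = ENNReal.ofReal ρ := by
    have : ∀ l, ENNReal.ofReal (channel r ρ i l) * (if l ≠ i then 1 else 0)
        = if l ≠ i then ENNReal.ofReal (ρ / (r - 1)) else 0 := by
      intro l
      by_cases h : l = i <;> simp [channel, h]
    rw [Finset.sum_congr rfl fun l _ => this l, ← Finset.sum_filter, Finset.sum_const,
      Finset.filter_ne', Finset.card_erase_of_mem (Finset.mem_univ _), Finset.card_univ,
      Fintype.card_fin, ← ENNReal.ofReal_nsmul, nsmul_eq_mul, Nat.cast_sub (by omega),
      Nat.cast_one, mul_div_cancel₀ _ hr'.ne']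
  refine ⟨?_, hsec⟩
  have : ∀ l, ENNReal.ofReal (channel r ρ i l) =
      (if l = i then ENNReal.ofReal (1 - ρ) else 0) +
      ENNReal.ofReal (channel r ρ i l) * (if l ≠ i then 1 else 0) := by
    intro l
    by_cases h : l = i <;> simp [channel, h]
  rw [Finset.sum_congr rfl fun l _ => this l, Finset.sum_add_distrib, hsec,
    Finset.sum_ite_eq' Finset.univ i]
  simp only [Finset.mem_univ, if_true]
  rw [← ENNReal.ofReal_add (by linarith) h0]
  simp

lemma sum_channelProb (hr : 2 ≤ r) {ρ : ℝ} (h0 : 0 ≤ ρ) (h1 : ρ ≤ 1) (x : Samples r m) :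
    ∑ z, channelProb ρ x z = 1 := by
  unfold channelProb
  have := Finset.prod_univ_sum (fun _ : Fin m => (Finset.univ : Finset (Fin r)))
    fun k l => ENNReal.ofReal (channel r ρ (x k) l)
  rw [Fintype.piFinset_univ] at this
  rw [← this]
  simp [(sum_channel hr h0 h1 _).1]

lemma sum_channelProb_ne (hr : 2 ≤ r) {ρ : ℝ} (h0 : 0 ≤ ρ) (h1 : ρ ≤ 1) (x : Samples r m)
    (k : Fin m) :
    ∑ z, channelProb ρ x z * (if z k ≠ x k then 1 else 0) = ENNReal.ofReal ρ := by
  unfold channelProb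
  -- The indicator is put in as a factor at coordinate `k`, so that the sum over strings still
  -- factorises.
  have := Finset.prod_univ_sum (fun _ : Fin m => (Finset.univ : Finset (Fin r)))
    fun k' l => ENNReal.ofReal (channel r ρ (x k') l) *
      if k' = k then (if l ≠ x k' then 1 else 0) else 1
  rw [Fintype.piFinset_univ] at this
  simp_rw [Finset.prod_mul_distrib, Finset.prod_ite_eq' Finset.univ k] at this
  simp only [Finset.mem_univ, if_true] at this
  rw [← this, Finset.prod_eq_single k]
  · simp only [if_true]
    exact (sum_channel hr h0 h1 _).2
  · intro k' _ hk
    simp [hk, (sum_channel hr h0 h1 _).1]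
  · simp

lemma sum_channelProb_mismatches (hr : 2 ≤ r) {ρ : ℝ} (h0 : 0 ≤ ρ) (h1 : ρ ≤ 1)
    (x : Samples r m) :
    ∑ z, channelProb ρ x z * ENNReal.ofReal (mismatches x z) = m * ENNReal.ofReal ρ := by
  have : ∀ z, ENNReal.ofReal (mismatches x z) = ∑ k, if z k ≠ x k then 1 else 0 := by
    intro z
    unfold mismatches
    rw [ENNReal.ofReal_sum_of_nonneg fun k _ => by split_ifs <;> norm_num]
    refine Finset.sum_congr rfl fun k _ => ?_
    split_ifs <;> simp
  simp_rw [this, Finset.mul_sum]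
  rw [Finset.sum_comm]
  simp_rw [sum_channelProb_ne hr h0 h1]
  simp

end Channel

/-! ### From conditional bounds to the law of one user. -/

section UserLaw

variable {r : ℕ} {E : Finset (Fin r × Fin r)} {dep : Fin r → Fin r}

/-- The probability of an event concerning one user, given the parameters `p` and the error
probability `ρ`. -/
def condProb (μ₀ : Measure (Fin r)) (p : Params E dep) (ρ : ℝ) {m : ℕ}
    (Q : Samples r m → Samples r m → Prop) : ℝ≥0∞ :=
  open Classical in
  ∑ x, chainProb E dep μ₀ p x * ∑ z, channelProb ρ x z * if Q x z then 1 else 0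

variable {f : Params E dep → ℝ≥0}

lemma IsParamDensity.ae_mem (hf : IsParamDensity E dep f) :
    ∀ᵐ p ∂paramLaw f, p ∈ paramRange E dep := by
  unfold paramLaw
  rw [ae_withDensity_iff hf.measurable.coe_nnreal_ennreal]
  refine Eventually.of_forall fun p hp => ?_
  by_contra h
  exact hp (by simp [hf.eq_zero p h])

lemma IsParamDensity.isProbabilityMeasure (hf : IsParamDensity E dep f) :
    IsProbabilityMeasure (paramLaw f) := by
  constructor
  rw [paramLaw, withDensity_apply _ MeasurableSet.univ, Measure.restrict_univ]
  exact hf.lintegral_eq_one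

lemma isProbabilityMeasure_noiseLaw {a : ℝ} (ha : 0 < a) : IsProbabilityMeasure (noiseLaw a) := by
  refine cond_isProbabilityMeasure_of_finite ?_ ?_ <;> simp [ha]

lemma ae_noiseLaw (a : ℝ) : ∀ᵐ ρ ∂noiseLaw a, ρ ∈ Set.Icc 0 a :=
  ae_cond_mem measurableSet_Icc

/-- A bound for the conditional probabilities bounds the probability. -/
lemma userLaw_le (hf : IsParamDensity E dep f) (init : Kernel (Params E dep) (Fin r)) {m : ℕ}
    {a : ℝ} (ha : 0 < a) {S : Set (UserOutcome E dep m)} (hS : MeasurableSet S)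
    (B : Params E dep → ℝ≥0∞)
    (h : ∀ p ∈ paramRange E dep, ∀ ρ ∈ Set.Icc 0 a,
      condProb (init p) p ρ (fun x z => ((p, ρ), (x, z)) ∈ S) ≤ B p) :
    userLaw f init m a S ≤ ∫⁻ p, B p ∂paramLaw f := by
  classical
  have := isProbabilityMeasure_noiseLaw ha
  have := hf.isProbabilityMeasure
  rw [userLaw, withDensity_apply _ hS, ← lintegral_indicator hS]
  -- Only upper bounds are wanted, so the inequality half of Tonelli suffices and measurability of
  -- the density is not needed.
  refine (lintegral_prod_le _).trans <| (lintegral_prod_le _).trans <| lintegral_mono_ae ?_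
  filter_upwards [hf.ae_mem] with p hp
  calc _ ≤ ∫⁻ _ρ, B p ∂noiseLaw a := by
        refine lintegral_mono_ae ?_
        filter_upwards [ae_noiseLaw a] with ρ hρ
        refine le_trans (le_of_eq ?_) (h p hp ρ hρ)
        rw [lintegral_count, tsum_fintype, Fintype.sum_prod_type]
        unfold condProb
        refine Finset.sum_congr rfl fun x _ => ?_
        rw [Finset.mul_sum]
        refine Finset.sum_congr rfl fun z _ => ?_
        by_cases hz : ((p, ρ), (x, z)) ∈ S <;> simp [Set.indicator, hz, channelProb]
    _ = B p := by simp

lemma condProb_le_one (hr : 2 ≤ r) (μ₀ : Measure (Fin r)) [IsProbabilityMeasure μ₀]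
    {p : Params E dep} (hp : p ∈ paramRange E dep) {ρ : ℝ} (h0 : 0 ≤ ρ) (h1 : ρ ≤ 1) {m : ℕ}
    (Q : Samples r m → Samples r m → Prop) : condProb μ₀ p ρ Q ≤ 1 := by
  classical
  rw [← sum_chainProb μ₀ hp m]
  refine Finset.sum_le_sum fun x _ => mul_le_of_le_one_right' ?_
  refine (Finset.sum_le_sum fun z _ => mul_le_of_le_one_right' ?_).trans_eq
    (sum_channelProb hr h0 h1 x)
  split_ifs <;> simp

lemma condProb_ne_le (hr : 2 ≤ r) (μ₀ : Measure (Fin r)) [IsProbabilityMeasure μ₀]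
    {p : Params E dep} (hp : p ∈ paramRange E dep) {ρ : ℝ} (h0 : 0 ≤ ρ) (h1 : ρ ≤ 1) {m : ℕ}
    (k : Fin m) : condProb μ₀ p ρ (fun x z => z k ≠ x k) ≤ ENNReal.ofReal ρ := by
  unfold condProb
  refine le_of_eq ?_
  calc _ = ∑ x, chainProb E dep μ₀ p x * ENNReal.ofReal ρ := by
        refine Finset.sum_congr rfl fun x _ => ?_
        rw [← sum_channelProb_ne hr h0 h1 x k]
        congr 1
        refine Finset.sum_congr rfl fun z _ => ?_
        split_ifs <;> rfl
    _ = ENNReal.ofReal ρ := by rw [← Finset.sum_mul, sum_chainProb μ₀ hp, one_mul]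

/-- The counts of the data are close to their compensators and few samples are reported wrongly,
except with small probability. -/
lemma condProb_atypical_le (hr : 2 ≤ r) (μ₀ : Measure (Fin r)) [IsProbabilityMeasure μ₀]
    {p : Params E dep} (hp : p ∈ paramRange E dep) {ρ : ℝ} (h0 : 0 ≤ ρ) (h1 : ρ ≤ 1) {m : ℕ}
    {s : ℝ} (hs : 0 < s) (Q : Samples r m → Samples r m → Prop)
    (hQ : ∀ x z, (∀ e ∈ E, |transitions x e.1 e.2 - transProb E dep p e.1 e.2 * visits x e.1| ≤ s)
      → mismatches x z ≤ s → ¬ Q x z) :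
    condProb μ₀ p ρ Q ≤ ENNReal.ofReal (E.card * (m / s ^ 2) + m * ρ / s) := by
  classical
  set D : Samples r m → Fin r × Fin r → ℝ :=
    fun x e => transitions x e.1 e.2 - transProb E dep p e.1 e.2 * visits x e.1 with hD
  -- Chebyshev for the counts and Markov for the misreports, as a pointwise bound on the indicator.
  have hpt : ∀ x z, (if Q x z then (1 : ℝ≥0∞) else 0) ≤
      ENNReal.ofReal (1 / s ^ 2) * ∑ e ∈ E, ENNReal.ofReal (D x e ^ 2) +
      ENNReal.ofReal (1 / s) * ENNReal.ofReal (mismatches x z) := by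
    intro x z
    split_ifs with h
    swap
    · exact zero_le
    by_cases hx : ∀ e ∈ E, |D x e| ≤ s
    · have hz : s < mismatches x z := by
        by_contra hz
        exact hQ x z hx (not_lt.1 hz) h
      refine le_trans ?_ le_add_self
      rw [← ENNReal.ofReal_mul (by positivity), ← ENNReal.ofReal_one]
      refine ENNReal.ofReal_le_ofReal ?_
      rw [one_div, inv_mul_eq_div, le_div_iff₀ hs]
      linarith
    · push Not at hx
      obtain ⟨e, he, hlt⟩ := hx
      refine le_trans ?_ le_self_add
      refine le_trans ?_ (mul_le_mul_right
        (Finset.single_le_sum (f := fun e => ENNReal.ofReal (D x e ^ 2))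
          (fun _ _ => zero_le) he) _)
      rw [← ENNReal.ofReal_mul (by positivity), ← ENNReal.ofReal_one]
      refine ENNReal.ofReal_le_ofReal ?_
      rw [one_div, inv_mul_eq_div, le_div_iff₀ (by positivity), one_mul, ← sq_abs (D x e)]
      gcongr
  have hin : ∀ x, (∑ z, channelProb ρ x z * if Q x z then 1 else 0) ≤
      ENNReal.ofReal (1 / s ^ 2) * ∑ e ∈ E, ENNReal.ofReal (D x e ^ 2) +
      ENNReal.ofReal (1 / s) * (m * ENNReal.ofReal ρ) := by
    intro x
    refine (Finset.sum_le_sum fun z _ => mul_le_mul_right (hpt x z) _).trans (le_of_eq ?_)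
    simp_rw [mul_add]
    rw [Finset.sum_add_distrib, ← Finset.sum_mul, sum_channelProb hr h0 h1, one_mul,
      ← sum_channelProb_mismatches hr h0 h1 x]
    congr 1
    rw [Finset.mul_sum]
    exact Finset.sum_congr rfl fun z _ => mul_left_comm _ _ _
  unfold condProb
  refine (Finset.sum_le_sum fun x _ => mul_le_mul_right (hin x) _).trans ?_
  simp_rw [mul_add]
  rw [Finset.sum_add_distrib, ← Finset.sum_mul, sum_chainProb μ₀ hp, one_mul,
    ENNReal.ofReal_add (by positivity) (by positivity)]
  gcongr
  · rw [Finset.sum_congr rfl fun x _ => mul_left_comm _ (ENNReal.ofReal (1 / s ^ 2)) _,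
      ← Finset.mul_sum, Finset.sum_congr rfl fun x _ => Finset.mul_sum _ _ _, Finset.sum_comm]
    refine (mul_le_mul_right (Finset.sum_le_sum fun e _ =>
      second_moment_le μ₀ hp e.1 e.2 m) _).trans (le_of_eq ?_)
    rw [Finset.sum_const, nsmul_eq_mul, ← ENNReal.ofReal_natCast, ← ENNReal.ofReal_natCast,
      ← ENNReal.ofReal_mul (by positivity), ← ENNReal.ofReal_mul (by positivity)]
    congr 1
    ring
  · rw [← ENNReal.ofReal_natCast, ← ENNReal.ofReal_mul (by positivity),
      ← ENNReal.ofReal_mul (by positivity)]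
    refine le_of_eq ?_
    congr 1
    ring

end UserLaw

/-! ### Choice of the threshold and of the fluctuation bound. -/

section Scales

lemma tendsto_natCast_rpow_neg {y : ℝ} (hy : 0 < y) :
    Tendsto (fun n : ℕ => (n : ℝ) ^ (-y)) atTop (𝓝 0) :=
  (tendsto_rpow_neg_atTop hy).comp tendsto_natCast_atTop_atTop

/-- There are a threshold `Δ` and a bound `s` for the fluctuations of the counts that suit the
numbers of samples `m` and the error probabilities `a`. -/
lemma exists_scales {d : ℕ} (hd : 0 < d) {c c' α β : ℝ} (hc : 0 < c) (hα : 0 < α)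
    (hβ : α / 4 < β) {m : ℕ → ℕ}
    (hm : ∀ n : ℕ, |(m n : ℝ) - c * (n : ℝ) ^ (2 / (d : ℝ) + α)| < 1) {a : ℕ → ℝ}
    (ha : ∀ n : ℕ, a n = c' * (n : ℝ) ^ (-(1 / (d : ℝ) + β))) :
    ∃ Δ s : ℕ → ℝ, (∀ᶠ n in atTop, 0 < Δ n) ∧ (∀ᶠ n in atTop, 0 < s n) ∧
      Tendsto (fun n : ℕ => n * (2 * Δ n) ^ d) atTop (𝓝 0) ∧
      (∀ C : ℝ, Tendsto (fun n => C * (m n / s n ^ 2) + m n * a n / s n) atTop (𝓝 0)) ∧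
      ∀ ν > 0, ∀ L : ℝ, ∀ᶠ n in atTop,
        4 * s n ≤ Δ n * (ν * (m n - 1 : ℕ) - L * (s n + 1) - s n) := by
  have hd' : (0 : ℝ) < d := by exact_mod_cast hd
  -- With `s = m Δ n^(-κ)`, the Chebyshev term is of order `n^(-(α/2 - 2κ))` and the misreport term
  -- of order `n^(-(β - α/4 - κ))`; this `κ` makes both decay and keeps `s` negligible against `m
  -- Δ`.
  set κ : ℝ := min (β - α / 4) (α / 4) / 2 with hκ
  have hκ0 : 0 < κ := half_pos (lt_min (by linarith) (by linarith))
  have hκ1 : κ < β - α / 4 := by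
    have := min_le_left (β - α / 4) (α / 4)
    linarith
  have hκ2 : κ < α / 4 := by
    have := min_le_right (β - α / 4) (α / 4)
    linarith
  have hy : 0 < 1 / (d : ℝ) := by positivity
  set Δ : ℕ → ℝ := fun n => (n : ℝ) ^ (-(1 / (d : ℝ) + α / 4)) with hΔ
  set η : ℕ → ℝ := fun n => (n : ℝ) ^ (-κ) with hη
  have hpos : ∀ᶠ n : ℕ in atTop, (0 : ℝ) < n := by
    filter_upwards [eventually_gt_atTop 0] with n hn
    exact_mod_cast hn
  have hΔ0 : ∀ᶠ n in atTop, 0 < Δ n := hpos.mono fun n hn => Real.rpow_pos_of_pos hn _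
  have hη0 : ∀ᶠ n in atTop, 0 < η n := hpos.mono fun n hn => Real.rpow_pos_of_pos hn _
  have hΔt : Tendsto Δ atTop (𝓝 0) := tendsto_natCast_rpow_neg (by linarith)
  have hηt : Tendsto η atTop (𝓝 0) := tendsto_natCast_rpow_neg hκ0
  have hmlow : ∀ᶠ n : ℕ in atTop, c / 2 * (n : ℝ) ^ (2 / (d : ℝ) + α) ≤ m n := by
    have h1 : Tendsto (fun n : ℕ => c / 2 * (n : ℝ) ^ (2 / (d : ℝ) + α)) atTop atTop :=
      ((tendsto_rpow_atTop (by positivity)).comp tendsto_natCast_atTop_atTop).const_mul_atTop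
        (by linarith)
    filter_upwards [h1.eventually_ge_atTop 1] with n hn
    have := (abs_lt.1 (hm n)).1
    linarith
  have hmt : Tendsto (fun n => (m n : ℝ)) atTop atTop := by
    refine tendsto_atTop_mono' _ hmlow ?_
    exact ((tendsto_rpow_atTop (by positivity)).comp tendsto_natCast_atTop_atTop).const_mul_atTop
        (by linarith)
  have hm0 : ∀ᶠ n in atTop, 0 < (m n : ℝ) := hmt.eventually_gt_atTop 0
  have hm1 : ∀ᶠ n in atTop, 1 ≤ m n := hm0.mono fun n hn => by exact_mod_cast hn
  have hmi : Tendsto (fun n => (m n : ℝ)⁻¹) atTop (𝓝 0) := hmt.inv_tendsto_atTop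
  refine ⟨Δ, fun n => m n * Δ n * η n, hΔ0, ?_, ?_, fun C => ?_, fun ν hν L => ?_⟩
  · filter_upwards [hΔ0, hη0, hm0] with n h1 h2 h3
    positivity
  · have h1 : Tendsto (fun n : ℕ => (2 : ℝ) ^ d * (n : ℝ) ^ (-(d * (α / 4)))) atTop (𝓝 0) := by
      simpa using (tendsto_natCast_rpow_neg (y := d * (α / 4)) (by positivity)).const_mul
        ((2 : ℝ) ^ d)
    refine h1.congr' ?_
    filter_upwards [hpos] with n hn
    rw [mul_pow, hΔ, mul_left_comm, ← Real.rpow_natCast ((n : ℝ) ^ _), ← Real.rpow_mul hn.le]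
    congr 1
    nth_rw 2 [← Real.rpow_one (n : ℝ)]
    rw [← Real.rpow_add hn]
    congr 1
    field_simp
    ring
  · have h1 : Tendsto (fun n : ℕ => (m n : ℝ) / (m n * Δ n * η n) ^ 2) atTop (𝓝 0) := by
      have h2 : Tendsto (fun n : ℕ => (2 / c) * (n : ℝ) ^ (-(α / 2 - 2 * κ))) atTop (𝓝 0) := by
        simpa using (tendsto_natCast_rpow_neg (y := α / 2 - 2 * κ) (by linarith)).const_mul
          (2 / c)
      refine squeeze_zero' ?_ ?_ h2
      · exact Eventually.of_forall fun n => by positivity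
      · filter_upwards [hpos, hmlow, hm0, hΔ0, hη0] with n hn h3 h4 h5 h6
        have h7 : (n : ℝ) ^ (2 / (d : ℝ) + α) * (Δ n ^ 2 * η n ^ 2)
            = (n : ℝ) ^ (α / 2 - 2 * κ) := by
          rw [hΔ, hη]
          simp only
          rw [← Real.rpow_natCast, ← Real.rpow_natCast, ← Real.rpow_mul hn.le,
            ← Real.rpow_mul hn.le, ← Real.rpow_add hn, ← Real.rpow_add hn]
          congr 1
          push_cast
          ring
        rw [show (m n : ℝ) / (m n * Δ n * η n) ^ 2 = 1 / (m n * (Δ n ^ 2 * η n ^ 2)) by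
          field_simp, Real.rpow_neg hn.le, ← h7, div_le_iff₀ (by positivity)]
        have h8 : 0 < (n : ℝ) ^ (2 / (d : ℝ) + α) := Real.rpow_pos_of_pos hn _
        have h9 : 2 / c * ((n : ℝ) ^ (2 / (d : ℝ) + α) * (Δ n ^ 2 * η n ^ 2))⁻¹ *
            (m n * (Δ n ^ 2 * η n ^ 2)) = m n / (c / 2 * (n : ℝ) ^ (2 / (d : ℝ) + α)) := by
          field_simp
        rw [h9, le_div_iff₀ (by positivity)]
        linarith
    have h2 : Tendsto (fun n : ℕ => (m n : ℝ) * a n / (m n * Δ n * η n)) atTop (𝓝 0) := by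
      have h3 : Tendsto (fun n : ℕ => c' * (n : ℝ) ^ (-(β - α / 4 - κ))) atTop (𝓝 0) := by
        simpa using (tendsto_natCast_rpow_neg (y := β - α / 4 - κ) (by linarith)).const_mul c'
      refine h3.congr' ?_
      filter_upwards [hpos, hm0, hΔ0, hη0] with n hn h4 h5 h6
      rw [mul_assoc, mul_div_mul_left _ _ h4.ne', eq_div_iff (by positivity), ha, hΔ, hη]
      simp only
      rw [← Real.rpow_add hn, mul_assoc, ← Real.rpow_add hn]
      congr 2
      ring
    simpa using (h1.const_mul C).add h2
  · have h1 : Tendsto (fun n => ν * (1 - (m n : ℝ)⁻¹) - L * (Δ n * η n + (m n : ℝ)⁻¹)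
        - Δ n * η n - 4 * η n) atTop
        (𝓝 (ν * (1 - 0) - L * (0 * 0 + 0) - 0 * 0 - 4 * 0)) :=
      ((((hmi.const_sub 1).const_mul ν).sub (((hΔt.mul hηt).add hmi).const_mul L)).sub
        (hΔt.mul hηt)).sub (hηt.const_mul 4)
    filter_upwards [hΔ0, hm0, hm1, h1.eventually_const_le (u := 0) (by simpa using hν)]
      with n h2 h3 h4 h5
    have h6 := mul_nonneg (mul_pos h2 h3).le h5
    rw [Nat.cast_sub h4, Nat.cast_one]
    have h7 : (m n : ℝ) * (m n : ℝ)⁻¹ = 1 := mul_inv_cancel₀ h3.ne'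
    have h8 : Δ n * m n * (ν * (1 - (m n : ℝ)⁻¹) - L * (Δ n * η n + (m n : ℝ)⁻¹)
        - Δ n * η n - 4 * η n) = Δ n * (ν * (m n - 1) - L * (m n * Δ n * η n + 1)
        - m n * Δ n * η n) - 4 * (m n * Δ n * η n) := by
      linear_combination (-Δ n * ν - Δ n * L) * h7
    linarith

end Scales

/-! ### The acceptance test and its two kinds of error. -/

section Test

variable {r : ℕ} {E : Finset (Fin r × Fin r)} {dep : Fin r → Fin r} {m : ℕ}

/-- The empirical transition frequencies of `z` agree with `p` up to `Δ`. -/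
def Accepts (Δ : ℝ) (p : Params E dep) (z : Samples r m) : Prop :=
  ∀ e : FreeEdge E dep, 0 < visits z e.1.1 ∧
    |transitions z e.1.1 e.1.2 - p e * visits z e.1.1| ≤ Δ * visits z e.1.1

lemma measurableSet_accepts (Δ : ℝ) :
    MeasurableSet {q : Params E dep × Samples r m | Accepts Δ q.1 q.2} := by
  unfold Accepts
  simp only [Set.ofPred_forall]
  refine MeasurableSet.iInter fun e => ?_
  have h1 : Measurable fun q : Params E dep × Samples r m => visits q.2 e.1.1 :=
    (measurable_visits _).comp measurable_snd
  have h2 : Measurable fun q : Params E dep × Samples r m => transitions q.2 e.1.1 e.1.2 :=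
    (measurable_transitions _ _).comp measurable_snd
  have h3 : Measurable fun q : Params E dep × Samples r m => q.1 e :=
    (measurable_pi_apply e).comp measurable_fst
  refine (measurableSet_lt measurable_const h1).inter (measurableSet_le ?_ (h1.const_mul Δ))
  exact continuous_abs.measurable.comp (h2.sub (h3.mul h1))

/-- The `4 * s` in `hlarge` is `s` for the martingale, `2 * s` for misreported transitions and `s`
for misreported visits; the bracket is a lower bound for the reported visits. -/
lemma accepts_of_typical (hr : 0 < r) {L : ℕ} (hL : ∀ i j, ∃ n ≤ L, HasWalk E n i j)
    {p : Params E dep} {θ s Δ : ℝ} (hθ : 0 < θ) (hθ1 : θ ≤ 1) (hs : 0 < s) (hΔ : 0 < Δ)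
    (hp : ∀ e ∈ E, θ ≤ transProb E dep p e.1 e.2)
    (hlarge : 4 * s ≤ Δ * (θ ^ L / r * (m - 1 : ℕ) - L * (s + 1) - s)) {x z : Samples r m}
    (hx : ∀ e ∈ E, |transitions x e.1 e.2 - transProb E dep p e.1 e.2 * visits x e.1| ≤ s)
    (hz : mismatches x z ≤ s) (hpr : p ∈ paramRange E dep) : Accepts Δ p z := by
  intro e
  obtain ⟨i, hi⟩ := exists_visits_ge hr x
  obtain ⟨n, hn, hw⟩ := hL i e.1.1
  have h1 := visits_ge_of_hasWalk hθ.le hθ1 hs.le hp hx n _ _ hw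
  have h2 : θ ^ L * (((m - 1 : ℕ) : ℝ) / r) ≤ θ ^ n * visits x i :=
    mul_le_mul (pow_le_pow_of_le_one hθ.le hθ1 hn) hi (by positivity) (by positivity)
  have h3 : (n : ℝ) * (s + 1) ≤ L * (s + 1) := by
    have : (n : ℝ) ≤ L := by exact_mod_cast hn
    gcongr
  have h4 := abs_le.1 (abs_visits_sub_le x z e.1.1)
  have h5 : θ ^ L / r * (m - 1 : ℕ) - L * (s + 1) - s ≤ visits z e.1.1 := by
    have : θ ^ L / r * (m - 1 : ℕ) = θ ^ L * (((m - 1 : ℕ) : ℝ) / r) := by ring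
    linarith
  have h6 : 4 * s ≤ Δ * visits z e.1.1 := hlarge.trans (mul_le_mul_of_nonneg_left h5 hΔ.le)
  refine ⟨pos_of_mul_pos_right (by linarith : 0 < Δ * visits z e.1.1) hΔ.le, ?_⟩
  have h7 := abs_le.1 (hx e.1 e.2.1)
  have h8 := abs_le.1 (abs_transitions_sub_le x z e.1.1 e.1.2)
  have hp0 := transProb_nonneg hpr e.1.1 e.1.2
  have hp1 := transProb_le_one hpr e.1.1 e.1.2
  rw [transProb_freeEdge] at h7 hp0 hp1
  have h9 : |p e * (visits z e.1.1 - visits x e.1.1)| ≤ s := by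
    rw [abs_mul, abs_of_nonneg hp0]
    calc p e * |visits z e.1.1 - visits x e.1.1| ≤ 1 * s :=
          mul_le_mul hp1 ((abs_visits_sub_le _ _ _).trans hz) (abs_nonneg _) zero_le_one
      _ = s := one_mul s
  have h10 := abs_le.1 h9
  rw [abs_le]
  constructor <;> linarith

variable {f : Params E dep → ℝ≥0}

/-- A given string is accepted for few parameter vectors only. -/
lemma paramLaw_accepts_le {δ : ℝ≥0} (hδ : ∀ p, f p ≤ δ) {Δ : ℝ} (hΔ : 0 ≤ Δ)
    (z : Samples r m) :
    paramLaw f {p | Accepts Δ p z} ≤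
      δ * ENNReal.ofReal ((2 * Δ) ^ Fintype.card (FreeEdge E dep)) := by
  -- The centre depends on `z` only. Acceptance forces positive visits, so the division is
  -- legitimate and every coordinate is constrained.
  set ctr : Params E dep := fun e => transitions z e.1.1 e.1.2 / visits z e.1.1 with hctr
  have hsub : {p | Accepts Δ p z} ⊆ Metric.closedBall ctr Δ := by
    intro p hp
    rw [Metric.mem_closedBall, dist_pi_le_iff hΔ]
    intro e
    obtain ⟨h1, h2⟩ := hp e
    rw [dist_comm, Real.dist_eq]
    have h3 : ctr e - p e = (transitions z e.1.1 e.1.2 - p e * visits z e.1.1)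
        / visits z e.1.1 := by
      rw [hctr]
      field_simp
    rw [h3, abs_div, abs_of_pos h1, div_le_iff₀ h1]
    exact h2
  refine (measure_mono hsub).trans ?_
  rw [paramLaw, withDensity_apply _ Metric.isClosed_closedBall.measurableSet]
  refine (lintegral_mono fun p => ENNReal.coe_le_coe.2 (hδ p)).trans ?_
  rw [setLIntegral_const, Real.volume_pi_closedBall _ hΔ]

/-- The parameter vectors that give some edge a probability below `θ`. -/
def smallEdge (E : Finset (Fin r × Fin r)) (dep : Fin r → Fin r) (θ : ℝ) :
    Set (Params E dep) :=
  {p | ∃ e ∈ E, transProb E dep p e.1 e.2 < θ}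

lemma measurableSet_smallEdge (θ : ℝ) : MeasurableSet (smallEdge E dep θ) := by
  have : smallEdge E dep θ = ⋃ e ∈ E, {p | transProb E dep p e.1 e.2 < θ} := by
    ext p
    simp [smallEdge]
  rw [this]
  exact Finset.measurableSet_biUnion _ fun e _ =>
    measurableSet_lt (measurable_transProb _ _) measurable_const

/-- An acceptable vector has finitely many, all positive, edge probabilities, so these sets decrease
to a null set. This stands in for a uniform lower bound on the edge probabilities. -/
lemma exists_paramLaw_smallEdge_le (hf : IsParamDensity E dep f) {ε : ℝ≥0∞} (hε : 0 < ε) :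
    ∃ θ : ℝ, 0 < θ ∧ θ ≤ 1 ∧ paramLaw f (smallEdge E dep θ) ≤ ε := by
  have := hf.isProbabilityMeasure
  have hanti : Antitone fun k : ℕ => smallEdge E dep (1 / ((k : ℝ) + 1)) := by
    rintro k l hkl p ⟨e, he, h⟩
    exact ⟨e, he, h.trans_le (one_div_le_one_div_of_le (by positivity) (by gcongr))⟩
  have hlim := tendsto_measure_iInter_atTop (μ := paramLaw f)
    (fun k : ℕ => (measurableSet_smallEdge (E := E) (dep := dep)
      (1 / ((k : ℝ) + 1))).nullMeasurableSet) hanti ⟨0, measure_ne_top _ _⟩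
  have hzero : paramLaw f (⋂ k : ℕ, smallEdge E dep (1 / ((k : ℝ) + 1))) = 0 := by
    refine measure_mono_null (fun p hp => ?_) (ae_iff.1 hf.ae_mem)
    intro hpr
    rw [Set.mem_iInter] at hp
    have hne : E.Nonempty := by
      obtain ⟨e, he, _⟩ := hp 0
      exact ⟨e, he⟩
    obtain ⟨e, he, hmin⟩ := E.exists_min_image (fun e => transProb E dep p e.1 e.2) hne
    obtain ⟨k, hk⟩ := exists_nat_one_div_lt (transProb_pos hpr he)
    obtain ⟨e', he', hlt⟩ := hp k
    exact absurd (hmin e' he') (not_le.2 (hlt.trans hk))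
  rw [hzero] at hlim
  obtain ⟨k, hk⟩ := ((ENNReal.tendsto_nhds_zero.1 hlim) ε hε).exists
  exact ⟨1 / ((k : ℝ) + 1), by positivity, by
    rw [div_le_one (by positivity)]; linarith [(Nat.cast_nonneg k : (0 : ℝ) ≤ k)], hk⟩

variable (init : Kernel (Params E dep) (Fin r)) [IsMarkovKernel init]

lemma userLaw_univ_le (hr : 2 ≤ r) (hf : IsParamDensity E dep f) {a : ℝ} (ha : 0 < a)
    (ha1 : a ≤ 1) : userLaw f init m a Set.univ ≤ 1 := by
  have := hf.isProbabilityMeasure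
  refine (userLaw_le hf init ha MeasurableSet.univ (fun _ => 1) fun p hp ρ hρ =>
    condProb_le_one hr _ hp hρ.1 (hρ.2.trans ha1) _).trans (by simp)

/-- The parameters of a user have the law `paramLaw f`. -/
lemma userLaw_param_le (hr : 2 ≤ r) (hf : IsParamDensity E dep f) {a : ℝ} (ha : 0 < a)
    (ha1 : a ≤ 1) {A : Set (Params E dep)} (hA : MeasurableSet A) :
    userLaw f init m a {ω | ω.1.1 ∈ A} ≤ paramLaw f A := by
  rw [← lintegral_indicator_one hA]
  refine userLaw_le hf init ha ((measurable_fst.comp measurable_fst) hA) _ fun p hp ρ hρ => ?_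
  by_cases h : p ∈ A
  · simpa [h] using condProb_le_one hr _ hp hρ.1 (hρ.2.trans ha1) _
  · simp [condProb, h]

lemma userLaw_misreported_le (hr : 2 ≤ r) (hf : IsParamDensity E dep f) {a : ℝ} (ha : 0 < a)
    (ha1 : a ≤ 1) (k : Fin m) :
    userLaw f init m a {ω | ω.2.2 k ≠ ω.2.1 k} ≤ ENNReal.ofReal a := by
  have := hf.isProbabilityMeasure
  refine (userLaw_le hf init ha ?_ (fun _ => ENNReal.ofReal a) fun p hp ρ hρ => ?_).trans
    (by simp)
  · exact measurable_snd (Set.to_countable {y : Samples r m × Samples r m |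
      y.2 k ≠ y.1 k}).measurableSet
  · exact (condProb_ne_le hr _ hp hρ.1 (hρ.2.trans ha1) k).trans (ENNReal.ofReal_le_ofReal hρ.2)

/-- The reported data of a user are accepted for the parameters of this user, except with small
probability. -/
lemma userLaw_reject_le (hr : 2 ≤ r) {L : ℕ} (hL : ∀ i j, ∃ n ≤ L, HasWalk E n i j)
    (hf : IsParamDensity E dep f) {a : ℝ} (ha : 0 < a) (ha1 : a ≤ 1) {θ s Δ : ℝ} (hθ : 0 < θ)
    (hθ1 : θ ≤ 1) (hs : 0 < s) (hΔ : 0 < Δ)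
    (hlarge : 4 * s ≤ Δ * (θ ^ L / r * (m - 1 : ℕ) - L * (s + 1) - s)) :
    userLaw f init m a {ω | ¬ Accepts Δ ω.1.1 ω.2.2} ≤
      paramLaw f (smallEdge E dep θ) + ENNReal.ofReal (E.card * (m / s ^ 2) + m * a / s) := by
  have := hf.isProbabilityMeasure
  -- The bound may depend on `p`: it is trivial where some edge is small and the typicality estimate
  -- elsewhere.
  refine (userLaw_le hf init ha ?_ (fun p => (smallEdge E dep θ).indicator 1 p +
    ENNReal.ofReal (E.card * (m / s ^ 2) + m * a / s)) fun p hp ρ hρ => ?_).trans ?_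
  · have h : Measurable fun ω : UserOutcome E dep m => (ω.1.1, ω.2.2) := by fun_prop
    exact h (measurableSet_accepts Δ).compl
  · by_cases h : p ∈ smallEdge E dep θ
    · refine le_trans ?_ le_self_add
      simpa [h] using condProb_le_one hr _ hp hρ.1 (hρ.2.trans ha1) _
    · refine le_trans ?_ le_add_self
      have hpθ : ∀ e ∈ E, θ ≤ transProb E dep p e.1 e.2 := by
        intro e he
        by_contra hlt
        exact h ⟨e, he, not_le.1 hlt⟩
      refine (condProb_atypical_le hr _ hp hρ.1 (hρ.2.trans ha1) hs _ fun x z hx hz => ?_).trans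
        (ENNReal.ofReal_le_ofReal ?_)
      · exact not_not.2
          (accepts_of_typical (by omega) hL hθ hθ1 hs hΔ hpθ hlarge hx hz hp)
      · have := hρ.2
        gcongr
  · rw [lintegral_add_right _ measurable_const,
      lintegral_indicator_one (measurableSet_smallEdge θ)]
    simp

end Test

/-! ### Independence of the users and the union bound. -/

section Experiment

/-- Independence enters here: user `0` is integrated first, with all other users frozen. -/
lemma pi_le_of_section_le {α : Type*} [MeasurableSpace α] {n : ℕ} (μ : Fin (n + 1) → Measure α)
    [∀ u, IsFiniteMeasure (μ u)] (hμ : ∀ u, μ u Set.univ ≤ 1) {T : Set (α × (Fin n → α))}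
    (hT : MeasurableSet T) {C : ℝ≥0∞} (hC : ∀ w, μ 0 {x | (x, w) ∈ T} ≤ C) :
    Measure.pi μ {w | (w 0, fun j : Fin n => w j.succ) ∈ T} ≤ C := by
  have h1 := (measurePreserving_piFinSuccAbove μ 0).measure_preimage hT.nullMeasurableSet
  have h2 : (MeasurableEquiv.piFinSuccAbove (fun _ : Fin (n + 1) => α) 0) ⁻¹' T
      = {w | (w 0, fun j : Fin n => w j.succ) ∈ T} := by
    ext w
    simp [MeasurableEquiv.piFinSuccAbove, Fin.insertNthEquiv, Fin.removeNth_zero, Fin.tail_def]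
  rw [← h2, h1, Measure.prod_apply_symm hT]
  refine (lintegral_mono fun w => hC w).trans ?_
  rw [lintegral_const, Measure.pi_univ]
  exact mul_le_of_le_one_right' (Finset.prod_le_one' fun j _ => hμ _)

variable {r : ℕ} {E : Finset (Fin r × Fin r)} {dep : Fin r → Fin r} {n m : ℕ}

/-- The pseudonym of user `0` is guessed to be one whose data are accepted. -/
def guess (Δ : ℝ) (K : Knowledge E dep (n + 1) m) : Fin (n + 1) :=
  open Classical in
  if h : ∃ j, Accepts Δ (K.1 0) (K.2 j) then h.choose else 0

/-- The data of user `0` are guessed to be those that are reported under the guessed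
pseudonym. -/
def guessData (Δ : ℝ) (K : Knowledge E dep (n + 1) m) : Samples r m := K.2 (guess Δ K)

lemma measurable_guess (Δ : ℝ) :
    Measurable (guess Δ : Knowledge E dep (n + 1) m → Fin (n + 1)) := by
  classical
  -- The arbitrary choice depends only on the acceptance pattern, which ranges over a finite
  -- discrete space, so it is measurable.
  set b : Knowledge E dep (n + 1) m → (Fin (n + 1) → Prop) :=
    fun K j => Accepts Δ (K.1 0) (K.2 j) with hb
  have hbm : Measurable b := by
    refine measurable_pi_lambda _ fun j => measurable_to_prop ?_
    have h : Measurable fun K : Knowledge E dep (n + 1) m => (K.1 0, K.2 j) := by fun_prop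
    have := h (measurableSet_accepts (E := E) (dep := dep) (m := m) Δ)
    convert this using 1
    ext K
    simp [hb]
  set g : (Fin (n + 1) → Prop) → Fin (n + 1) :=
    fun v => if h : ∃ j, v j then h.choose else 0 with hg
  have hgm : Measurable g := Measurable.of_discrete
  exact hgm.comp hbm

lemma measurable_guessData (Δ : ℝ) :
    Measurable (guessData Δ : Knowledge E dep (n + 1) m → Samples r m) := by
  have h : Measurable fun q : (Fin (n + 1) → Samples r m) × Fin (n + 1) => q.1 q.2 :=
    Measurable.of_discrete
  exact h.comp (measurable_snd.prodMk (measurable_guess Δ))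

lemma guess_eq {Δ : ℝ} (ω : Outcome E dep (n + 1) m)
    (h0 : Accepts Δ (ω.1 0).1.1 (ω.1 0).2.2)
    (h1 : ∀ j : Fin n, ¬ Accepts Δ (ω.1 0).1.1 (ω.1 j.succ).2.2) :
    guess Δ (knowledge ω) = ω.2 0 := by
  have hex : ∃ j, Accepts Δ ((knowledge ω).1 0) ((knowledge ω).2 j) := by
    refine ⟨ω.2 0, ?_⟩
    simpa [knowledge, anonymized, obfuscated] using h0
  have hspec := hex.choose_spec
  rw [guess, dif_pos hex]
  set j := hex.choose
  rcases Fin.eq_zero_or_eq_succ (ω.2.symm j) with h | ⟨u, hu⟩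
  · rw [← h, Equiv.apply_symm_apply]
  · exfalso
    refine h1 u ?_
    rw [← hu]
    exact hspec

variable {f : Params E dep → ℝ≥0} (init : ℕ → Kernel (Params E dep) (Fin r))

lemma law_le_pi (a : ℝ) (A : Set (Fin (n + 1) → UserOutcome E dep m)) :
    law f init (n + 1) m a {ω | ω.1 ∈ A} ≤
      Measure.pi (fun u : Fin (n + 1) => userLaw f (init u) m a) A := by
  have : {ω : Outcome E dep (n + 1) m | ω.1 ∈ A} = A ×ˢ Set.univ := by
    ext ω
    simp
  rw [law, this, Measure.prod_prod, measure_univ, mul_one]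

variable [∀ u, IsMarkovKernel (init u)]

lemma identificationError_le (hr : 2 ≤ r) {L : ℕ} (hL : ∀ i j, ∃ n ≤ L, HasWalk E n i j)
    (hf : IsParamDensity E dep f) {δ : ℝ≥0} (hδ : ∀ p, f p ≤ δ) {a : ℝ} (ha : 0 < a)
    (ha1 : a ≤ 1) {θ s Δ : ℝ} (hθ : 0 < θ) (hθ1 : θ ≤ 1) (hs : 0 < s) (hΔ : 0 < Δ)
    (hlarge : 4 * s ≤ Δ * (θ ^ L / r * (m - 1 : ℕ) - L * (s + 1) - s)) :
    identificationError (law f init (n + 1) m a) (guess Δ) 0 ≤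
      paramLaw f (smallEdge E dep θ) + ENNReal.ofReal (E.card * (m / s ^ 2) + m * a / s) +
      n * (δ * ENNReal.ofReal ((2 * Δ) ^ Fintype.card (FreeEdge E dep))) := by
  have hμ : ∀ u : Fin (n + 1), userLaw f (init u) m a Set.univ ≤ 1 :=
    fun u => userLaw_univ_le (init u) hr hf ha ha1
  have : ∀ u : Fin (n + 1), IsFiniteMeasure (userLaw f (init u) m a) :=
    fun u => ⟨(hμ u).trans_lt ENNReal.one_lt_top⟩
  set T₀ : Set (UserOutcome E dep m × (Fin n → UserOutcome E dep m)) :=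
    {q | ¬ Accepts Δ q.1.1.1 q.1.2.2} with hT₀
  set T₁ : Fin n → Set (UserOutcome E dep m × (Fin n → UserOutcome E dep m)) :=
    fun j => {q | Accepts Δ q.1.1.1 (q.2 j).2.2} with hT₁
  have hm₀ : MeasurableSet T₀ := by
    have h : Measurable fun q : UserOutcome E dep m × (Fin n → UserOutcome E dep m) =>
      (q.1.1.1, q.1.2.2) := by fun_prop
    exact h (measurableSet_accepts Δ).compl
  have hm₁ : ∀ j, MeasurableSet (T₁ j) := by
    intro j
    have h : Measurable fun q : UserOutcome E dep m × (Fin n → UserOutcome E dep m) =>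
      (q.1.1.1, (q.2 j).2.2) := by fun_prop
    exact h (measurableSet_accepts Δ)
  have hsub : {ω : Outcome E dep (n + 1) m | guess Δ (knowledge ω) ≠ ω.2 0} ⊆
      {ω | ω.1 ∈ {w : Fin (n + 1) → UserOutcome E dep m |
        (w 0, fun j : Fin n => w j.succ) ∈ T₀} ∪
        ⋃ j, {w | (w 0, fun j : Fin n => w j.succ) ∈ T₁ j}} := by
    intro ω hω
    by_contra hcon
    simp only [hT₀, hT₁, Set.mem_ofPred_eq, Set.mem_union, Set.mem_iUnion, not_or, not_not,
      not_exists] at hcon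
    exact hω (guess_eq ω hcon.1 hcon.2)
  refine (measure_mono hsub).trans <| (law_le_pi init a _).trans <|
    (measure_union_le _ _).trans ?_
  refine add_le_add (pi_le_of_section_le _ hμ hm₀ fun w =>
    userLaw_reject_le _ hr hL hf ha ha1 hθ hθ1 hs hΔ hlarge) ?_
  refine (measure_iUnion_fintype_le _ _).trans ?_
  calc _ ≤ ∑ _j : Fin n, δ * ENNReal.ofReal ((2 * Δ) ^ Fintype.card (FreeEdge E dep)) := by
        -- The string of the rival is fixed; the randomness used is that of the parameters of user
        -- `0`.
        refine Finset.sum_le_sum fun j _ => pi_le_of_section_le _ hμ (hm₁ j) fun w => ?_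
        have h : Measurable fun p : Params E dep => (p, (w j).2.2) := by fun_prop
        exact (userLaw_param_le _ hr hf ha ha1 (h (measurableSet_accepts Δ))).trans
          (paramLaw_accepts_le hδ hΔ.le _)
    _ = _ := by simp

/-- Under a correct guess only a misreport of the sample itself can hurt. The bound does not depend
on `k`, hence survives the supremum. -/
lemma recoveryError_le (hr : 2 ≤ r) (hf : IsParamDensity E dep f) {a : ℝ} (ha : 0 < a)
    (ha1 : a ≤ 1) (Δ : ℝ) (k : Fin m) :
    recoveryError (law f init (n + 1) m a) (guessData Δ) 0 k ≤
      identificationError (law f init (n + 1) m a) (guess Δ) 0 + ENNReal.ofReal a := by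
  have hμ : ∀ u : Fin (n + 1), userLaw f (init u) m a Set.univ ≤ 1 :=
    fun u => userLaw_univ_le (init u) hr hf ha ha1
  have : ∀ u : Fin (n + 1), IsFiniteMeasure (userLaw f (init u) m a) :=
    fun u => ⟨(hμ u).trans_lt ENNReal.one_lt_top⟩
  set T : Set (UserOutcome E dep m × (Fin n → UserOutcome E dep m)) :=
    {q | q.1.2.2 k ≠ q.1.2.1 k} with hT
  have hmT : MeasurableSet T :=
    (measurable_snd.comp measurable_fst) (Set.to_countable {y : Samples r m × Samples r m |
      y.2 k ≠ y.1 k}).measurableSet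
  have hsub : {ω : Outcome E dep (n + 1) m | guessData Δ (knowledge ω) k ≠ userData ω 0 k} ⊆
      {ω | guess Δ (knowledge ω) ≠ ω.2 0} ∪
      {ω | ω.1 ∈ {w : Fin (n + 1) → UserOutcome E dep m |
        (w 0, fun j : Fin n => w j.succ) ∈ T}} := by
    intro ω hω
    by_contra hcon
    simp only [hT, Set.mem_ofPred_eq, Set.mem_union, not_or, not_not] at hcon
    refine hω ?_
    rw [guessData, hcon.1]
    simp only [knowledge, anonymized, obfuscated, Equiv.symm_apply_apply]
    exact hcon.2
  refine (measure_mono hsub).trans <| (measure_union_le _ _).trans <| add_le_add le_rfl <|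
    (law_le_pi init a _).trans ?_
  exact pi_le_of_section_le _ hμ hmT fun w => userLaw_misreported_le _ hr hf ha ha1 k

end Experiment

end MarkovPrivacy

end

/-! ### Passage to the limit. -/

theorem theorem5 (r : ℕ) (hr : 2 ≤ r) (E : Finset (Fin r × Fin r))
    (hirr : MarkovPrivacy.IsIrreducible E) (hap : MarkovPrivacy.IsAperiodic E)
    (dep : Fin r → Fin r) (hdep : ∀ i, (i, dep i) ∈ E)
    (c c' α β : ℝ) (hc : 0 < c) (hc' : 0 < c') (hα : 0 < α) (hβ : α / 4 < β)
    (m : ℕ → ℕ)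
    (hm : ∀ n : ℕ, |(m n : ℝ) - c * (n : ℝ) ^ (2 / ((E.card : ℝ) - r) + α)| < 1)
    (a : ℕ → ℝ) (ha : ∀ n : ℕ, a n = c' * (n : ℝ) ^ (-(1 / ((E.card : ℝ) - r) + β))) :
    ∃ (identify : ∀ n : ℕ, MarkovPrivacy.Knowledge E dep (n + 1) (m (n + 1)) → Fin (n + 1))
      (recover : ∀ n : ℕ, MarkovPrivacy.Knowledge E dep (n + 1) (m (n + 1)) →
        MarkovPrivacy.Samples r (m (n + 1))),
      (∀ n, Measurable (identify n)) ∧ (∀ n, Measurable (recover n)) ∧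
      ∀ (f : MarkovPrivacy.Params E dep → ℝ≥0), MarkovPrivacy.IsParamDensity E dep f →
      ∀ (init : ℕ → Kernel (MarkovPrivacy.Params E dep) (Fin r)),
        (∀ u, IsMarkovKernel (init u)) →
        Tendsto (fun n : ℕ =>
          MarkovPrivacy.identificationError
            (MarkovPrivacy.law f init (n + 1) (m (n + 1)) (a (n + 1))) (identify n) 0)
          atTop (𝓝 0) ∧
        Tendsto (fun n : ℕ => ⨆ k : Fin (m (n + 1)),
          MarkovPrivacy.recoveryError
            (MarkovPrivacy.law f init (n + 1) (m (n + 1)) (a (n + 1))) (recover n) 0 k)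
          atTop (𝓝 0) := by
  have := MarkovPrivacy.nonempty_freeEdge hr hirr hap hdep
  have hd : 0 < Fintype.card (MarkovPrivacy.FreeEdge E dep) := Fintype.card_pos
  have hcard : (E.card : ℝ) - r = Fintype.card (MarkovPrivacy.FreeEdge E dep) := by
    rw [← MarkovPrivacy.card_freeEdge hdep]
    push_cast
    ring
  simp only [hcard] at hm ha
  obtain ⟨L, hL⟩ := MarkovPrivacy.exists_walk_length_le hirr
  obtain ⟨Δ, s, hΔ, hs, hvol, hfluct, hlarge⟩ := MarkovPrivacy.exists_scales hd hc hα hβ hm ha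
  -- The threshold `Δ` is fixed before `f` and `init` appear, so the estimators do not depend on
  -- them.
  refine ⟨fun n => MarkovPrivacy.guess (Δ (n + 1)), fun n => MarkovPrivacy.guessData (Δ (n + 1)),
    fun n => MarkovPrivacy.measurable_guess _, fun n => MarkovPrivacy.measurable_guessData _,
    fun f hf init hinit => ?_⟩
  obtain ⟨δ, hδ⟩ := hf.bounded
  have hat : Tendsto a atTop (𝓝 0) := by
    have hpos : 0 < 1 / (Fintype.card (MarkovPrivacy.FreeEdge E dep) : ℝ) + β := by
      have : 0 < 1 / (Fintype.card (MarkovPrivacy.FreeEdge E dep) : ℝ) := by positivity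
      linarith
    have h := (MarkovPrivacy.tendsto_natCast_rpow_neg hpos).const_mul c'
    rw [mul_zero] at h
    exact h.congr fun n => (ha n).symm
  have ha0 : ∀ᶠ n in atTop, 0 < a n := by
    filter_upwards [eventually_gt_atTop 0] with n hn
    have : (0 : ℝ) < n := by exact_mod_cast hn
    rw [ha]
    positivity
  have ha1 : ∀ᶠ n in atTop, a n ≤ 1 := hat.eventually_le_const one_pos
  have hrest : Tendsto (fun n : ℕ =>
      ENNReal.ofReal (E.card * (m n / s n ^ 2) + m n * a n / s n) +
      δ * ENNReal.ofReal (n * (2 * Δ n) ^ Fintype.card (MarkovPrivacy.FreeEdge E dep)))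
      atTop (𝓝 0) := by
    have h1 := ENNReal.tendsto_ofReal (hfluct E.card)
    have h2 := ENNReal.Tendsto.const_mul (a := (δ : ℝ≥0∞)) (ENNReal.tendsto_ofReal hvol)
      (Or.inr ENNReal.coe_ne_top)
    simpa using h1.add h2
  have hident : Tendsto (fun n : ℕ =>
      MarkovPrivacy.identificationError
        (MarkovPrivacy.law f init (n + 1) (m (n + 1)) (a (n + 1)))
        (MarkovPrivacy.guess (Δ (n + 1))) 0) atTop (𝓝 0) := by
    rw [ENNReal.tendsto_nhds_zero]
    intro ε hε
    -- `θ` depends on `ε` but not on `n`, so `hlarge` applies with the constant `θ ^ L / r`. Half of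
    -- `ε` pays for small edges, half for the rest.
    obtain ⟨θ, hθ, hθ1, hθε⟩ :=
      MarkovPrivacy.exists_paramLaw_smallEdge_le hf (ENNReal.half_pos hε.ne')
    have hrpos : (0 : ℝ) < r := by exact_mod_cast (by omega : 0 < r)
    have hev := ((((hΔ.and hs).and (ha0.and ha1)).and
      (hlarge (θ ^ L / r) (by positivity) L)).and
      (ENNReal.tendsto_nhds_zero.1 hrest _ (ENNReal.half_pos hε.ne')))
    filter_upwards [(tendsto_add_atTop_nat 1).eventually hev]
      with n ⟨⟨⟨⟨hΔn, hsn⟩, ha0n, ha1n⟩, hln⟩, hrn⟩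
    refine (MarkovPrivacy.identificationError_le init hr hL hf hδ ha0n ha1n hθ hθ1 hsn hΔn
      hln).trans ?_
    rw [add_assoc, ← ENNReal.add_halves ε]
    refine add_le_add hθε ((add_le_add le_rfl ?_).trans hrn)
    rw [ENNReal.ofReal_mul (by positivity), ENNReal.ofReal_natCast, mul_left_comm]
    gcongr
    omega
  refine ⟨hident, ?_⟩
  have hbound := hident.add
    (ENNReal.tendsto_ofReal ((tendsto_add_atTop_iff_nat (f := a) 1).2 hat))
  rw [ENNReal.ofReal_zero, add_zero] at hbound
  refine tendsto_of_tendsto_of_tendsto_of_le_of_le' tendsto_const_nhds hbound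
    (Eventually.of_forall fun _ => zero_le) ?_
  filter_upwards [(tendsto_add_atTop_nat 1).eventually (ha0.and ha1)] with n ⟨ha0n, ha1n⟩
  exact iSup_le fun k => MarkovPrivacy.recoveryError_le init hr hf ha0n ha1n _ k
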